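/- Let $n\ge 1$, let $\mu_1,\dots,\mu_n\in\mathbb{R}$ and $\sigma_1,\dots,\sigma_n>0$, and let $X_1,\dots,X_n$ be independent random variables such that $X_j$ has the lognormal distribution $\ln\mathcal N(\mu_j,\sigma_j^2)$, that is, $X_j$ has density $\frac{1}{\sqrt{2\pi}\,\sigma_j x}\exp\left(-\frac{(\ln x-\mu_j)^2}{2\sigma_j^2}\right)$ on $(0,\infty)$. Put $X=\sum_{j=1}^n X_j$. Then the Laplace transform $z\mapsto\mathbb{E}[e^{-zX}]$, $\operatorname{Re} z>0$, has a (unique) analytic continuation $\varphi$ to $\mathbb{C}\setminus(-\infty,0]$; the limit $\varphi(-t+i\cdot 0):=\lim_{\varepsilon\to0^+}\varphi(-t+i\varepsilon)$ exists for every $t>0$; and $X$ has a continuous density on $(0,\infty)$, given by $$f_X(x)=-\frac1\pi\int_0^\infty \operatorname{Im}\left[\varphi(-t+i\cdot 0)\right]e^{-tx}\,dt,\qquad x>0,$$ where the integral converges absolutely for every $x>0$. -/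

import Mathlib

open MeasureTheory ProbabilityTheory Filter Topology Set

noncomputable section

/-- The density of the lognormal distribution with parameters `m` and `s ^ 2`
(extended by `0` to the nonpositive reals). -/
def lognormalPDF (m s x : ℝ) : ℝ :=
  if 0 < x then
    1 / (Real.sqrt (2 * Real.pi) * s * x) * Real.exp (-(Real.log x - m) ^ 2 / (2 * s ^ 2))
  else 0

/-- The lognormal distribution with parameters `m` and `s ^ 2` (for `0 < s`). -/
def lognormalMeasure (m s : ℝ) : Measure ℝ :=
  volume.withDensity fun x => ENNReal.ofReal (lognormalPDF m s x)

/-- The Laplace transform `z ↦ E[exp (-z X)]` of a real random variable `X`. -/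
def laplaceTransform {Ω : Type*} [MeasurableSpace Ω] (X : Ω → ℝ) (P : Measure Ω) (z : ℂ) : ℂ :=
  ∫ ω, Complex.exp (-z * (X ω : ℂ)) ∂P

/-- `φ` is an analytic continuation, from the open right half plane to the plane slit along
`(-∞, 0]`, of the Laplace transform of `X`. -/
structure IsLaplaceContinuation {Ω : Type*} [MeasurableSpace Ω] (X : Ω → ℝ) (P : Measure Ω)
    (φ : ℂ → ℂ) : Prop where
  holomorphic : DifferentiableOn ℂ φ Complex.slitPlane
  eq_laplaceTransform : ∀ z : ℂ, 0 < z.re → φ z = laplaceTransform X P z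

/-- The boundary value `φ (-t + i0)`, the limit of `φ (-t + i ε)` as `ε → 0+`. -/
def upperBoundaryValue (φ : ℂ → ℂ) (t : ℝ) : ℂ :=
  limUnder (𝓝[>] (0 : ℝ)) fun ε : ℝ => φ (-(t : ℂ) + Complex.I * (ε : ℂ))

/-- The real-valued function `f`, regarded on `(0, ∞)` only, is a probability density of `X`:
it is nonnegative there and the law of `X` is `f(x) dx` on `(0, ∞)`. -/
def IsDensityOnIoi {Ω : Type*} [MeasurableSpace Ω] (X : Ω → ℝ) (P : Measure Ω)
    (f : ℝ → ℝ) : Prop :=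
  (∀ x : ℝ, 0 < x → 0 ≤ f x) ∧
    HasLaw X ((volume.restrict (Ioi (0 : ℝ))).withDensity fun x => ENNReal.ofReal (f x)) P

/-- The function `x ↦ -(1/π) ∫₀^∞ Im[φ (-t + i0)] exp (-t x) dt`. -/
def inversionIntegral (φ : ℂ → ℂ) (x : ℝ) : ℝ :=
  -(1 / Real.pi) * ∫ t in Ioi (0 : ℝ), (upperBoundaryValue φ t).im * Real.exp (-t * x)

end

/-!
In the coordinate `w = log z` the Laplace transform of the lognormal distribution becomes
`E[exp (-exp (w + Y))]` with `Y` normal. For real `w`, the Cameron–Martin formula moves the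
translation by `w` from the integrand to the measure; the result, `lognormalLogLaplace`, makes sense
for all complex `w` and is entire. So `φ z = Φ (log z)` with an entire `Φ`, a product over the
summands by independence; the boundary values at `-t` are `Φ (log t + iπ)`.

The same formula bounds `Φ w` on the closed strip `|Im w| ≤ π` by a constant and by a multiple of
`exp (-Re w)`, and `Φ w - 1` by a multiple of `exp (Re w)`. These conditions, `StripRegular`, pass to
products and suffice for the inversion. Cauchy's theorem for rectangles in the `w`-plane
(`StripRegular.integral_im_mul_div`) shows that `φ` is on `Re z > 0` the Stieltjes transform of
`κ t = -(1 / π) Im φ (-t + i0)`. By Fubini this is the Laplace transform of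
`h x = ∫ κ t exp (-t x) dt`, which is integrable over `(0, ∞)` because `κ t / t` is. Uniqueness of
Laplace transforms (`nonneg_and_eq_withDensity_of_laplace_eq`) identifies `h` as the density; that
`h ≥ 0` is a consequence, since `h` is continuous.
-/

open scoped NNReal

/-! ### Entire functions with controlled growth on the strip -/

/-- The conditions on `Φ` under which the inversion formula is derived. Here `Φ w` stands for
`φ (exp w)`, so that the slit plane becomes the open strip `|Im w| < π`, the two sides of the slit
become the lines `Im w = ±π`, and `Φ`, being entire, supplies the boundary values. The bounds say
that, uniformly up to the slit, `φ` is bounded, `φ z = O(1 / |z|)` and `φ z - 1 = O(|z|)`. -/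
structure StripRegular (Φ : ℂ → ℂ) : Prop where
  differentiable : Differentiable ℂ Φ
  conj_apply : ∀ w, Φ (starRingEnd ℂ w) = starRingEnd ℂ (Φ w)
  exists_bound : ∃ C : ℝ, 0 ≤ C ∧ ∀ w : ℂ, |w.im| ≤ Real.pi →
    ‖Φ w‖ ≤ C ∧ ‖Φ w‖ ≤ C * Real.exp (-w.re) ∧ ‖Φ w - 1‖ ≤ C * Real.exp w.re

namespace StripRegular

variable {Φ Ψ : ℂ → ℂ}

theorem mul (hΦ : StripRegular Φ) (hΨ : StripRegular Ψ) : StripRegular fun w => Φ w * Ψ w := by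
  refine ⟨hΦ.differentiable.mul hΨ.differentiable,
    fun w => by simp [hΦ.conj_apply, hΨ.conj_apply], ?_⟩
  obtain ⟨C, hC, hCb⟩ := hΦ.exists_bound
  obtain ⟨D, hD, hDb⟩ := hΨ.exists_bound
  refine ⟨C * D + D, by positivity, fun w hw => ?_⟩
  obtain ⟨h1, h2, h3⟩ := hCb w hw
  obtain ⟨k1, k2, k3⟩ := hDb w hw
  have e1 := Real.exp_pos (-w.re)
  have e2 := Real.exp_pos w.re
  refine ⟨?_, ?_, ?_⟩
  · rw [norm_mul]
    have := mul_le_mul h1 k1 (norm_nonneg _) hC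
    linarith
  · rw [norm_mul]
    have := mul_le_mul h1 k2 (norm_nonneg _) hC
    nlinarith [mul_nonneg hD e1.le]
  · calc ‖Φ w * Ψ w - 1‖ = ‖(Φ w - 1) * Ψ w + (Ψ w - 1)‖ := by congr 1; ring
      _ ≤ ‖Φ w - 1‖ * ‖Ψ w‖ + ‖Ψ w - 1‖ := by
        rw [← norm_mul]; exact norm_add_le _ _
      _ ≤ (C * Real.exp w.re) * D + D * Real.exp w.re := by gcongr
      _ = _ := by ring

theorem prod {ι : Type*} {s : Finset ι} (hs : s.Nonempty) {G : ι → ℂ → ℂ}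
    (hG : ∀ i ∈ s, StripRegular (G i)) : StripRegular fun w => ∏ i ∈ s, G i w := by
  induction hs using Finset.Nonempty.cons_induction with
  | singleton a => simpa using hG a (by simp)
  | cons a s ha hs ih =>
    simp only [Finset.prod_cons]
    exact (hG a (by simp)).mul (ih fun i hi => hG i (by simp [hi]))

theorem im_bound (hΦ : StripRegular Φ) : ∃ C : ℝ, 0 ≤ C ∧ ∀ x : ℝ,
    |(Φ (x + Real.pi * Complex.I)).im| ≤ C ∧
    |(Φ (x + Real.pi * Complex.I)).im| ≤ C * Real.exp (-x) ∧
    |(Φ (x + Real.pi * Complex.I)).im| ≤ C * Real.exp x := by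
  obtain ⟨C, hC, hCb⟩ := hΦ.exists_bound
  refine ⟨C, hC, fun x => ?_⟩
  have := hCb (x + Real.pi * Complex.I) (by simp [abs_of_pos Real.pi_pos])
  simp only [Complex.add_re, Complex.ofReal_re, Complex.mul_re, Complex.I_re, mul_zero,
    Complex.ofReal_im, Complex.I_im, mul_one, sub_self, add_zero] at this
  refine ⟨(Complex.abs_im_le_norm _).trans this.1, (Complex.abs_im_le_norm _).trans this.2.1, ?_⟩
  refine le_trans ?_ this.2.2
  simpa using Complex.abs_im_le_norm (Φ (x + Real.pi * Complex.I) - 1)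

theorem continuous_im (hΦ : StripRegular Φ) :
    Continuous fun x : ℝ => (Φ (x + Real.pi * Complex.I)).im := by
  have := hΦ.differentiable.continuous
  fun_prop

/-- The two sides of the slit carry a jump that is `O(exp (-|x|))` on the logarithmic scale:
decay for `x → ∞` comes from that of `Φ`, and for `x → -∞` from `Φ - 1`, as `1` is real. -/
theorem integrable_im (hΦ : StripRegular Φ) :
    Integrable fun x : ℝ => (Φ (x + Real.pi * Complex.I)).im := by
  obtain ⟨C, hC, hCb⟩ := hΦ.im_bound
  rw [← integrableOn_univ, ← Iic_union_Ioi (a := (0 : ℝ))]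
  refine IntegrableOn.union ?_ ?_
  · exact ((integrableOn_exp_Iic 0).const_mul C).mono'
      hΦ.continuous_im.aestronglyMeasurable (.of_forall fun x => (hCb x).2.2)
  · exact ((integrableOn_exp_neg_Ioi 0).const_mul C).mono'
      hΦ.continuous_im.aestronglyMeasurable (.of_forall fun x => (hCb x).2.1)

end StripRegular

/-! ### Cauchy's formula in the logarithmic coordinate -/

/-- The Cauchy kernel `dζ / (ζ - z)` in the coordinate `ζ = exp w`. -/
noncomputable def cauchyKernel (z w : ℂ) : ℂ := Complex.exp w / (Complex.exp w - z)

theorem norm_cauchyKernel_le_right {z w : ℂ} (h : 2 * ‖z‖ ≤ Real.exp w.re) :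
    ‖cauchyKernel z w‖ ≤ 2 := by
  have e := Real.exp_pos w.re
  have h1 : Real.exp w.re / 2 ≤ ‖Complex.exp w - z‖ := by
    have := norm_sub_norm_le (Complex.exp w) z
    rw [Complex.norm_exp] at this
    linarith
  rw [cauchyKernel, norm_div, Complex.norm_exp, div_le_iff₀ (by linarith)]
  linarith

theorem norm_cauchyKernel_le_left {z w : ℂ} (h : 2 * Real.exp w.re ≤ ‖z‖) :
    ‖cauchyKernel z w‖ ≤ 2 * Real.exp w.re / ‖z‖ := by
  have e := Real.exp_pos w.re
  have h1 : ‖z‖ / 2 ≤ ‖Complex.exp w - z‖ := by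
    have := norm_sub_norm_le z (Complex.exp w)
    rw [Complex.norm_exp, norm_sub_rev] at this
    linarith
  rw [cauchyKernel, norm_div, Complex.norm_exp, div_le_div_iff₀ (by linarith) (by linarith)]
  nlinarith

theorem tendsto_cauchyKernel_right (z : ℂ) (y : ℝ) :
    Tendsto (fun R : ℝ => cauchyKernel z (R + y * Complex.I)) atTop (𝓝 1) := by
  have h0 : Tendsto (fun R : ℝ => Complex.exp (-(R + y * Complex.I))) atTop (𝓝 0) := by
    rw [tendsto_zero_iff_norm_tendsto_zero]
    simpa [Complex.norm_exp] using Real.tendsto_exp_neg_atTop_nhds_zero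
  have h1 : Tendsto (fun R : ℝ => (1 - z * Complex.exp (-(R + y * Complex.I)))⁻¹) atTop
      (𝓝 (1 - z * 0)⁻¹) :=
    ((tendsto_const_nhds).sub (h0.const_mul z)).inv₀ (by simp)
  simp only [mul_zero, sub_zero, inv_one] at h1
  refine h1.congr fun R => ?_
  have := Complex.exp_ne_zero (R + y * Complex.I)
  rw [cauchyKernel, Complex.exp_neg]
  have e : 1 - z * (Complex.exp (R + y * Complex.I))⁻¹
      = (Complex.exp (R + y * Complex.I) - z) / Complex.exp (R + y * Complex.I) := by
    field_simp
  rw [e, inv_div]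

/-- The product of the kernel with `Φ - Φ w₀` has a removable singularity at `w₀`, and `w₀` is the
only zero of `exp w - exp w₀` in the closed strip `|Im w| ≤ π`. -/
theorem exists_differentiableOn_cauchyKernel_mul {Φ : ℂ → ℂ} (hΦ : Differentiable ℂ Φ) {w₀ : ℂ}
    (hw₀ : |w₀.im| < Real.pi) :
    ∃ f : ℂ → ℂ, DifferentiableOn ℂ f {w | |w.im| ≤ Real.pi} ∧
      ∀ w, w ≠ w₀ → f w = (Φ w - Φ w₀) * cauchyKernel (Complex.exp w₀) w := by
  have hd : ∀ F : ℂ → ℂ, Differentiable ℂ F → Differentiable ℂ (dslope F w₀) := fun F hF => by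
    rw [← differentiableOn_univ]
    exact (Complex.differentiableOn_dslope univ_mem).2 hF.differentiableOn
  refine ⟨fun w => dslope Φ w₀ w * Complex.exp w / dslope Complex.exp w₀ w, ?_, ?_⟩
  · refine DifferentiableOn.div ((hd Φ hΦ).mul Complex.differentiable_exp).differentiableOn
      (hd _ Complex.differentiable_exp).differentiableOn fun w hw => ?_
    by_cases h : w = w₀
    · subst h
      simp [dslope_same, Complex.exp_ne_zero]
    · rw [dslope_of_ne _ h, slope_def_field]
      refine div_ne_zero (fun he => h ?_) (sub_ne_zero.2 h)
      obtain ⟨n, hn⟩ := Complex.exp_eq_exp_iff_exists_int.1 (sub_eq_zero.1 he)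
      have him := congrArg Complex.im hn
      simp at him
      have hw' := abs_le.1 (show |w.im| ≤ Real.pi from hw)
      have hw0 := abs_lt.1 hw₀
      have hpi := Real.pi_pos
      have h1 : n < 1 := by
        by_contra! hc
        have : (1 : ℝ) ≤ n := by exact_mod_cast hc
        nlinarith
      have h2 : -1 < n := by
        by_contra! hc
        have : (n : ℝ) ≤ -1 := by exact_mod_cast hc
        nlinarith
      have : n = 0 := by omega
      simpa [this] using hn
  · intro w hw
    have h1 : w - w₀ ≠ 0 := sub_ne_zero.2 hw
    simp only [dslope_of_ne _ hw, slope_def_field, cauchyKernel]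
    by_cases h2 : Complex.exp w - Complex.exp w₀ = 0
    · simp [h2]
    · field_simp

/-- Cauchy's formula, with the contour pushed onto the slit. Integrate
`(Φ w - Φ w₀) exp w / (exp w - z)`, where `w₀ = log z`, around `[-R, R] × [-π, π]`. The kernel takes
the same values on both horizontal sides, so these combine to the jump of `Φ`; for
`R → ∞` the right side tends to `-2πi Φ w₀`, and the left one to `0`. -/
theorem StripRegular.integral_im_mul_div {Φ : ℂ → ℂ} (hΦ : StripRegular Φ) {z : ℂ} (hz : 0 < z.re) :
    ∫ x : ℝ, ((Φ (x + Real.pi * Complex.I)).im : ℂ) * (Complex.exp x / (Complex.exp x + z))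
      = -Real.pi * Φ (Complex.log z) := by
  set w₀ := Complex.log z with hw₀
  have hz0 : z ≠ 0 := by rintro rfl; simp at hz
  have hexp : Complex.exp w₀ = z := Complex.exp_log hz0
  have hpi := Real.pi_pos
  have him : |w₀.im| < Real.pi := by
    rw [hw₀, Complex.log_im]
    have := (Complex.abs_arg_lt_pi_div_two_iff).2 (Or.inl hz)
    linarith
  obtain ⟨f, hf, hfe⟩ := exists_differentiableOn_cauchyKernel_mul hΦ.differentiable him
  rw [hexp] at hfe
  obtain ⟨C, hC, hCb⟩ := hΦ.exists_bound
  set J : ℝ → ℂ := fun x =>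
    ((Φ (x + Real.pi * Complex.I)).im : ℂ) * (Complex.exp x / (Complex.exp x + z)) with hJ
  have hne : ∀ x : ℝ, Complex.exp x + z ≠ 0 := fun x h => by
    have := congrArg Complex.re h
    simp [Complex.exp_ofReal_re] at this
    linarith [Real.exp_pos x]
  have hJi : Integrable J := by
    have hc : Continuous J := by
      have := hΦ.continuous_im
      refine (Complex.continuous_ofReal.comp this).mul (Continuous.div (by fun_prop) (by fun_prop) hne)
    refine hΦ.integrable_im.norm.mono' hc.aestronglyMeasurable (.of_forall fun x => ?_)
    have : ‖Complex.exp x / (Complex.exp x + z)‖ ≤ 1 := by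
      rw [norm_div]
      refine div_le_one_of_le₀ ?_ (norm_nonneg _)
      calc ‖Complex.exp x‖ = Real.exp x := by simp [Complex.norm_exp]
        _ ≤ (Complex.exp x + z).re := by
          simp [Complex.exp_ofReal_re]; exact hz.le
        _ ≤ _ := Complex.re_le_norm _
    rw [hJ, norm_mul, Complex.norm_real]
    exact mul_le_of_le_one_right (norm_nonneg _) this
  -- `exp w = -exp x` at `w = x ± πi`, and the values of `Φ` there are conjugate.
  have hhor : ∀ x : ℝ, f (x + (-Real.pi : ℝ) * Complex.I) - f (x + (Real.pi : ℝ) * Complex.I)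
      = -2 * Complex.I * J x := fun x => by
    have hw0 := abs_lt.1 him
    rw [hfe _ (fun h => by have := congrArg Complex.im h; simp at this; linarith),
      hfe _ (fun h => by have := congrArg Complex.im h; simp at this; linarith)]
    have e1 : Complex.exp (x + (-Real.pi : ℝ) * Complex.I) = -Complex.exp x := by
      rw [Complex.exp_add]; push_cast; rw [neg_mul, Complex.exp_neg, Complex.exp_pi_mul_I]
      norm_num
    have e2 : Complex.exp (x + (Real.pi : ℝ) * Complex.I) = -Complex.exp x := by
      rw [Complex.exp_add, Complex.exp_pi_mul_I]; ring
    have e3 : Φ (x + (-Real.pi : ℝ) * Complex.I)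
        = starRingEnd ℂ (Φ (x + (Real.pi : ℝ) * Complex.I)) := by
      rw [← hΦ.conj_apply]; simp
    have e4 : -Complex.exp x / (-Complex.exp x - z) = Complex.exp x / (Complex.exp x + z) := by
      rw [← neg_add', neg_div_neg_eq]
    have e5 := Complex.sub_conj (Φ (x + (Real.pi : ℝ) * Complex.I))
    push_cast at e5
    simp only [cauchyKernel, e1, e2, e3, e4, hJ]
    linear_combination (-(Complex.exp x / (Complex.exp x + z))) * e5
  have hrect : ∀ᶠ R : ℝ in atTop,
      -2 * Complex.I * (∫ x in -R..R, J x)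
        + Complex.I * (∫ y in -Real.pi..Real.pi, f (R + y * Complex.I))
        - Complex.I * (∫ y in -Real.pi..Real.pi, f ((-R : ℝ) + y * Complex.I)) = 0 := by
    refine .of_forall fun R => ?_
    have hcont : ContinuousOn f {w | |w.im| ≤ Real.pi} := hf.continuousOn
    have key := Complex.integral_boundary_rect_eq_zero_of_differentiableOn f
      ((-R : ℝ) + (-Real.pi : ℝ) * Complex.I) (R + Real.pi * Complex.I) (hf.mono fun w hw => by
        have := hw.2
        simp [uIcc_of_le (by linarith : -Real.pi ≤ Real.pi)] at this
        exact abs_le.2 this)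
    simp only [Complex.add_re, Complex.ofReal_re, Complex.mul_re, Complex.I_re, mul_zero,
      Complex.ofReal_im, Complex.I_im, mul_one, sub_self, add_zero, Complex.add_im,
      Complex.mul_im, zero_add, smul_eq_mul] at key
    rw [← intervalIntegral.integral_sub, intervalIntegral.integral_congr (g := fun x => -2 * Complex.I * J x)
      (fun x _ => hhor x), intervalIntegral.integral_const_mul] at key
    · exact key
    all_goals
      refine Continuous.intervalIntegrable (hcont.comp_continuous (by fun_prop) fun x => ?_) _ _
      simp [abs_of_pos hpi]
  have hstrip : ∀ {y : ℝ}, y ∈ uIoc (-Real.pi) Real.pi → |y| ≤ Real.pi := fun {y} hy => by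
    rw [uIoc_of_le (by linarith)] at hy
    exact abs_le.2 ⟨hy.1.le, hy.2⟩
  have hznorm : 0 < ‖z‖ := norm_pos_iff.2 hz0
  have hΦ0 : ∀ w : ℂ, |w.im| ≤ Real.pi → ‖Φ w - Φ w₀‖ ≤ C + ‖Φ w₀‖ := fun w hw =>
    (norm_sub_le _ _).trans (by gcongr; exact (hCb w hw).1)
  have hmeas : ∀ R : ℝ, AEStronglyMeasurable (fun y : ℝ => f (R + y * Complex.I))
      (volume.restrict (uIoc (-Real.pi) Real.pi)) := fun R => by
    refine ContinuousOn.aestronglyMeasurable ?_ measurableSet_uIoc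
    refine hf.continuousOn.comp (by fun_prop) fun y hy => ?_
    simpa using hstrip hy
  have hright : Tendsto (fun R : ℝ => ∫ y in -Real.pi..Real.pi, f (R + y * Complex.I)) atTop
      (𝓝 (∫ y in -Real.pi..Real.pi, -Φ w₀)) := by
    refine intervalIntegral.tendsto_integral_filter_of_dominated_convergence
      (fun _ => (C + ‖Φ w₀‖) * 2) (.of_forall hmeas) ?_ (by simp) (.of_forall fun y hy => ?_)
    · filter_upwards [Real.tendsto_exp_atTop.eventually_ge_atTop (2 * ‖z‖),
        eventually_gt_atTop w₀.re] with R hR hR0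
      refine .of_forall fun y hy => ?_
      rw [hfe _ (fun h => by have := congrArg Complex.re h; simp at this; linarith), norm_mul]
      gcongr
      · exact hΦ0 _ (by simpa using hstrip hy)
      · exact norm_cauchyKernel_le_right (by simpa using hR)
    · have h1 : Tendsto (fun R : ℝ => Φ (R + y * Complex.I)) atTop (𝓝 0) := by
        refine squeeze_zero_norm (fun R => (hCb _ (by simpa using hstrip hy)).2.1) ?_
        simpa using Real.tendsto_exp_neg_atTop_nhds_zero.const_mul C
      have h2 := (h1.sub_const (Φ w₀)).mul (tendsto_cauchyKernel_right z y)
      rw [zero_sub, mul_one] at h2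
      refine h2.congr' ?_
      filter_upwards [eventually_gt_atTop w₀.re] with R hR0
      rw [hfe _ (fun h => by have := congrArg Complex.re h; simp at this; linarith)]
  have hleft : Tendsto (fun R : ℝ => ∫ y in -Real.pi..Real.pi, f ((-R : ℝ) + y * Complex.I)) atTop
      (𝓝 0) := by
    have hlim : Tendsto (fun R : ℝ => (C + ‖Φ w₀‖) * (2 * Real.exp (-R) / ‖z‖)
        * |Real.pi - -Real.pi|) atTop (𝓝 0) := by
      have := ((((Real.tendsto_exp_neg_atTop_nhds_zero).const_mul 2).div_const ‖z‖).const_mul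
        (C + ‖Φ w₀‖)).mul_const |Real.pi - -Real.pi|
      simpa using this
    refine squeeze_zero_norm' ?_ hlim
    have hs := (Real.tendsto_exp_neg_atTop_nhds_zero.const_mul 2)
    rw [mul_zero] at hs
    filter_upwards [hs.eventually_le_const hznorm, eventually_gt_atTop (-w₀.re)] with R hR hR0
    refine intervalIntegral.norm_integral_le_of_norm_le_const fun y hy => ?_
    rw [hfe _ (fun h => by have := congrArg Complex.re h; simp at this; linarith), norm_mul]
    gcongr
    · exact hΦ0 _ (by simpa using hstrip hy)
    · have := norm_cauchyKernel_le_left (z := z) (w := (-R : ℝ) + y * Complex.I) (by simpa using hR)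
      simpa using this
  have hmid := intervalIntegral_tendsto_integral hJi tendsto_neg_atTop_atBot tendsto_id
  have hall := ((hmid.const_mul (-2 * Complex.I)).add (hright.const_mul Complex.I)).sub
    (hleft.const_mul Complex.I)
  have h0 := tendsto_nhds_unique (tendsto_const_nhds.congr' (hrect.mono fun R h => h.symm)) hall
  rw [intervalIntegral.integral_const] at h0
  simp only [Complex.real_smul] at h0
  push_cast at h0
  have h2I : (-2 * Complex.I) ≠ 0 := by simp
  refine mul_left_cancel₀ h2I ?_
  linear_combination -h0

/-! ### Uniqueness for Laplace transforms -/

/-- Laplace transforms on `Re z > 0` determine, by a limit, the Fourier transform. -/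
theorem tendsto_integral_mul_exp_nhdsGT {ν : Measure ℝ} (hν : ∀ᵐ x ∂ν, 0 ≤ x) {F : ℝ → ℂ}
    (hF : Integrable F ν) (τ : ℝ) :
    Tendsto (fun ε : ℝ => ∫ x, F x * Complex.exp (-(ε - τ * Complex.I) * x) ∂ν) (𝓝[>] 0)
      (𝓝 (∫ x, F x * Complex.exp (τ * x * Complex.I) ∂ν)) := by
  refine tendsto_integral_filter_of_dominated_convergence (fun x => ‖F x‖) ?_ ?_ hF.norm ?_
  · exact .of_forall fun ε => hF.aestronglyMeasurable.mul
      (Continuous.aestronglyMeasurable (by fun_prop))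
  · filter_upwards [self_mem_nhdsWithin] with ε hε
    filter_upwards [hν] with x hx
    rw [norm_mul, Complex.norm_exp]
    refine mul_le_of_le_one_right (norm_nonneg _) ?_
    have : 0 ≤ ε * x := mul_nonneg (le_of_lt hε) hx
    simpa using this
  · refine .of_forall fun x => ?_
    have hc : Continuous fun ε : ℝ => F x * Complex.exp (-(ε - τ * Complex.I) * x) := by fun_prop
    have := (hc.tendsto 0).mono_left (nhdsWithin_le_nhds (s := Ioi 0))
    convert this using 4
    push_cast; ring

/-- Uniqueness for Laplace transforms, with a candidate density that is not known to be
nonnegative: it then is, and it is the density. Its positive and negative parts define finite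
measures, and `ρ` plus the second is the first, by comparison of characteristic functions. -/
theorem nonneg_and_eq_withDensity_of_laplace_eq {ρ : Measure ℝ} [IsFiniteMeasure ρ]
    (hρ : ∀ᵐ x ∂ρ, 0 ≤ x) {h : ℝ → ℝ} (hc : ContinuousOn h (Ioi 0))
    (hi : IntegrableOn h (Ioi 0))
    (heq : ∀ z : ℂ, 0 < z.re → ∫ x, Complex.exp (-z * x) ∂ρ
      = ∫ x in Ioi (0 : ℝ), (h x : ℂ) * Complex.exp (-z * x)) :
    (∀ x, 0 < x → 0 ≤ h x) ∧
      ρ = (volume.restrict (Ioi (0 : ℝ))).withDensity fun x => ENNReal.ofReal (h x) := by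
  set lam : Measure ℝ := volume.restrict (Ioi (0 : ℝ)) with hlam
  have hi' : Integrable h lam := hi
  have hin : Integrable (fun x => -h x) lam := hi'.neg
  have hchar : ∀ τ : ℝ, charFun ρ τ = ∫ x, (h x : ℂ) * Complex.exp (τ * x * Complex.I) ∂lam := by
    intro τ
    have hpos : ∀ᵐ x ∂lam, 0 ≤ x :=
      (ae_restrict_mem measurableSet_Ioi).mono fun x hx => le_of_lt hx
    have h1 := tendsto_integral_mul_exp_nhdsGT hρ (integrable_const (1 : ℂ)) τ
    have h2 := tendsto_integral_mul_exp_nhdsGT hpos hi'.ofReal τ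
    simp only [one_mul] at h1
    rw [charFun_apply_real]
    refine tendsto_nhds_unique (h1.congr' ?_) h2
    filter_upwards [self_mem_nhdsWithin] with ε hε
    exact heq _ (by simpa using hε)
  set νp := lam.withDensity fun x => ENNReal.ofReal (h x) with hνp
  set νm := lam.withDensity fun x => ENNReal.ofReal (-h x) with hνm
  have : IsFiniteMeasure νp := isFiniteMeasure_withDensity_ofReal hi'.2
  have : IsFiniteMeasure νm := isFiniteMeasure_withDensity_ofReal hi'.neg.2
  have hdens : ∀ g : ℝ → ℝ, Integrable g lam → ∀ F : ℝ → ℂ,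
      ∫ x, F x ∂(lam.withDensity fun x => ENNReal.ofReal (g x))
        = ∫ x, ((max (g x) 0 : ℝ) : ℂ) * F x ∂lam := fun g hg F => by
    rw [integral_withDensity_eq_integral_toReal_smul₀ hg.aestronglyMeasurable.aemeasurable.ennreal_ofReal
      (.of_forall fun x => ENNReal.ofReal_lt_top)]
    simp [ENNReal.toReal_ofReal']
  have hint : ∀ (g : ℝ → ℝ), Integrable g lam → ∀ τ : ℝ,
      Integrable (fun x => (g x : ℂ) * Complex.exp (τ * x * Complex.I)) lam := fun g hg τ => by
    refine hg.ofReal.mul_bdd (c := 1) (Continuous.aestronglyMeasurable (by fun_prop))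
      (.of_forall fun x => ?_)
    simp [Complex.norm_exp]
  have hsum : ρ + νm = νp := by
    refine Measure.ext_of_charFun (funext fun τ => ?_)
    have hb : ∀ (m : Measure ℝ) [IsFiniteMeasure m],
        Integrable (fun x : ℝ => Complex.exp (τ * x * Complex.I)) m := fun m _ =>
      (integrable_const (1 : ℝ)).mono' (Continuous.aestronglyMeasurable (by fun_prop))
        (.of_forall fun x => by simp [Complex.norm_exp])
    rw [charFun_apply_real, integral_add_measure (hb _) (hb _), ← charFun_apply_real, hchar,
      charFun_apply_real, hνm, hdens _ hin, hνp, hdens _ hi',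
      ← integral_add (hint _ hi' τ) (hint _ hin.pos_part τ)]
    refine integral_congr_ae (.of_forall fun x => ?_)
    simp only
    rw [← add_mul, ← Complex.ofReal_add]
    congr 2
    rcases le_total 0 (h x) with hx | hx
    · rw [max_eq_left hx, max_eq_right (by linarith), add_zero]
    · rw [max_eq_right hx, max_eq_left (by linarith)]; ring
  -- The open set where `h < 0` is null for the positive part, hence for the negative part.
  have hnn : ∀ x, 0 < x → 0 ≤ h x := by
    by_contra! hcon
    obtain ⟨x₀, hx₀, hneg⟩ := hcon
    set A : Set ℝ := Ioi 0 ∩ h ⁻¹' Iio 0 with hA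
    have hAo : IsOpen A := hc.isOpen_inter_preimage isOpen_Ioi isOpen_Iio
    have hAm : MeasurableSet A := hAo.measurableSet
    have hAp : νp A = 0 := by
      rw [hνp, withDensity_apply _ hAm]
      refine (setLIntegral_congr_fun hAm fun x hx => ?_).trans lintegral_zero
      exact ENNReal.ofReal_eq_zero.2 (le_of_lt hx.2)
    have hAm0 : νm A = 0 := by
      have := congrArg (fun m : Measure ℝ => m A) hsum
      simp only [Measure.add_apply, hAp] at this
      exact (add_eq_zero.1 this).2
    rw [hνm, withDensity_apply _ hAm, lintegral_eq_zero_iff'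
      hin.aestronglyMeasurable.aemeasurable.restrict.ennreal_ofReal] at hAm0
    have hnull : (lam.restrict A) A = 0 := by
      have hF : ∀ᵐ x ∂(lam.restrict A), False := by
        filter_upwards [hAm0, ae_restrict_mem hAm] with x hx hxA
        have h1 : h x < 0 := hxA.2
        have h2 : -h x ≤ 0 := ENNReal.ofReal_eq_zero.1 hx
        linarith
      exact measure_mono_null (fun x _ => by simp) (ae_iff.1 hF)
    rw [Measure.restrict_apply_self, hlam, Measure.restrict_apply hAm,
      inter_eq_left.2 (by rw [hA]; exact inter_subset_left)] at hnull
    exact (hAo.measure_pos volume ⟨x₀, hx₀, hneg⟩).ne' hnull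
  refine ⟨hnn, ?_⟩
  have hm0 : νm = 0 := by
    rw [hνm, withDensity_eq_zero_iff hin.aestronglyMeasurable.aemeasurable.ennreal_ofReal]
    filter_upwards [ae_restrict_mem measurableSet_Ioi] with x hx
    exact ENNReal.ofReal_eq_zero.2 (by have := hnn x hx; linarith)
  rwa [hm0, add_zero] at hsum

/-! ### Iterated Laplace transforms -/

theorem integrable_mul_exp_prod {κ : ℝ → ℝ}
    (hκm : AEStronglyMeasurable κ (volume.restrict (Ioi 0)))
    (hκ : IntegrableOn (fun t => κ t / t) (Ioi 0)) :
    Integrable (fun p : ℝ × ℝ => κ p.1 * Real.exp (-p.1 * p.2))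
      ((volume.restrict (Ioi 0)).prod (volume.restrict (Ioi 0))) := by
  rw [integrable_prod_iff]
  · constructor
    · filter_upwards [ae_restrict_mem measurableSet_Ioi] with t ht
      exact (integrableOn_exp_mul_Ioi (neg_lt_zero.2 ht) 0).const_mul _
    · refine hκ.norm.congr ?_
      filter_upwards [ae_restrict_mem measurableSet_Ioi] with t ht
      have ht' : (0 : ℝ) < t := ht
      simp only [norm_mul, Real.norm_eq_abs, Real.abs_exp]
      rw [integral_const_mul, integral_exp_mul_Ioi (neg_lt_zero.2 ht'), abs_div, abs_of_pos ht']
      simp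
      ring
  · exact hκm.comp_fst.mul (Continuous.aestronglyMeasurable (by fun_prop))

theorem integrableOn_laplace {κ : ℝ → ℝ}
    (hκm : AEStronglyMeasurable κ (volume.restrict (Ioi 0)))
    (hκ : IntegrableOn (fun t => κ t / t) (Ioi 0)) :
    IntegrableOn (fun x => ∫ t in Ioi 0, κ t * Real.exp (-t * x)) (Ioi 0) :=
  (integrable_mul_exp_prod hκm hκ).integral_prod_right

/-- The Laplace transform of a Laplace transform is a Stieltjes transform. -/
theorem integral_laplace_mul_exp {κ : ℝ → ℝ}
    (hκm : AEStronglyMeasurable κ (volume.restrict (Ioi 0)))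
    (hκ : IntegrableOn (fun t => κ t / t) (Ioi 0)) {z : ℂ} (hz : 0 < z.re) :
    ∫ x in Ioi (0 : ℝ), ((∫ t in Ioi 0, κ t * Real.exp (-t * x) : ℝ) : ℂ) * Complex.exp (-z * x)
      = ∫ t in Ioi (0 : ℝ), (κ t : ℂ) / (t + z) := by
  have hprod := (integrable_mul_exp_prod hκm hκ).ofReal (𝕜 := ℂ)
  have hprod' : Integrable (Function.uncurry fun t x : ℝ =>
      (((κ t * Real.exp (-t * x) : ℝ) : ℂ) * Complex.exp (-z * x)))
      ((volume.restrict (Ioi 0)).prod (volume.restrict (Ioi 0))) := by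
    refine hprod.mul_bdd (c := 1) (Continuous.aestronglyMeasurable (by fun_prop)) ?_
    have hae : ∀ᵐ p : ℝ × ℝ ∂((volume.restrict (Ioi 0)).prod (volume.restrict (Ioi 0))),
        p ∈ Ioi (0 : ℝ) ×ˢ Ioi (0 : ℝ) := by
      rw [Measure.prod_restrict]
      exact ae_restrict_mem (measurableSet_Ioi.prod measurableSet_Ioi)
    filter_upwards [hae] with p hp
    have : 0 ≤ z.re * p.2 := mul_nonneg hz.le (le_of_lt hp.2)
    simpa [Complex.norm_exp] using this
  simp_rw [← integral_complex_ofReal, ← integral_mul_const]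
  rw [← integral_integral_swap hprod']
  refine setIntegral_congr_fun measurableSet_Ioi fun t ht => ?_
  have ht' : (0 : ℝ) < t := ht
  have hre : (-(t + z) : ℂ).re < 0 := by simp; linarith
  have hne : (t + z : ℂ) ≠ 0 := fun h => by simp [h] at hre
  have : ∀ x : ℝ, ((κ t * Real.exp (-t * x) : ℝ) : ℂ) * Complex.exp (-z * x)
      = (κ t : ℂ) * Complex.exp (-(t + z) * x) := fun x => by
    push_cast
    rw [mul_assoc, ← Complex.exp_add]
    congr 2; ring
  simp_rw [this]
  rw [integral_const_mul, integral_exp_mul_complex_Ioi hre]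
  simp only [Complex.ofReal_zero, mul_zero, Complex.exp_zero]
  rw [neg_div_neg_eq, mul_one_div]

theorem integrableOn_mul_exp {κ : ℝ → ℝ} (hκm : AEStronglyMeasurable κ (volume.restrict (Ioi 0)))
    {C : ℝ} (hC : ∀ t, 0 < t → |κ t| ≤ C) {x : ℝ} (hx : 0 < x) :
    IntegrableOn (fun t => κ t * Real.exp (-t * x)) (Ioi 0) := by
  have h1 : IntegrableOn (fun t => Real.exp (-t * x)) (Ioi 0) := by
    refine (integrableOn_exp_mul_Ioi (neg_lt_zero.2 hx) 0).congr_fun (fun t _ => ?_) measurableSet_Ioi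
    simp only; congr 1; ring
  refine Integrable.bdd_mul (c := C) h1 hκm ?_
  filter_upwards [ae_restrict_mem measurableSet_Ioi] with t ht using hC t ht

theorem continuousOn_laplace {κ : ℝ → ℝ} (hκm : AEStronglyMeasurable κ (volume.restrict (Ioi 0)))
    {C : ℝ} (hC : ∀ t, 0 < t → |κ t| ≤ C) :
    ContinuousOn (fun x => ∫ t in Ioi 0, κ t * Real.exp (-t * x)) (Ioi 0) := by
  intro x hx
  have hx' : (0 : ℝ) < x := hx
  refine ContinuousAt.continuousWithinAt ?_
  refine continuousAt_of_dominated (bound := fun t => ‖κ t * Real.exp (-t * (x / 2))‖) ?_ ?_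
    (integrableOn_mul_exp hκm hC (half_pos hx')).norm (.of_forall fun t => by fun_prop)
  · exact .of_forall fun y => hκm.mul (Continuous.aestronglyMeasurable (by fun_prop))
  · filter_upwards [lt_mem_nhds (half_lt_self hx')] with y hy
    filter_upwards [ae_restrict_mem measurableSet_Ioi] with t ht
    have ht' : (0 : ℝ) < t := ht
    simp only [norm_mul, Real.norm_eq_abs, Real.abs_exp]
    exact mul_le_mul_of_nonneg_left (Real.exp_le_exp.2 (by nlinarith)) (abs_nonneg _)

/-! ### The lognormal distribution -/

theorem lognormalMeasure_eq_map_gaussianReal (m : ℝ) {s : ℝ} (hs : 0 < s) :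
    lognormalMeasure m s = (gaussianReal m ⟨s ^ 2, sq_nonneg s⟩).map Real.exp := by
  set v : ℝ≥0 := ⟨s ^ 2, sq_nonneg s⟩ with hv
  have hv0 : v ≠ 0 := by
    intro h
    have : s ^ 2 = 0 := congrArg NNReal.toReal h
    exact hs.ne' (by simpa using this)
  ext A hA
  rw [Measure.map_apply Real.measurable_exp hA, gaussianReal_apply m hv0, lognormalMeasure,
    withDensity_apply _ hA, ← lintegral_inter_add_sdiff _ A (measurableSet_Ioi (a := (0 : ℝ)))]
  have hzero : ∫⁻ x in A \ Ioi 0, ENNReal.ofReal (lognormalPDF m s x) = 0 := by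
    refine (setLIntegral_congr_fun (hA.diff measurableSet_Ioi) fun x hx => ?_).trans lintegral_zero
    have : ¬ (0 < x) := hx.2
    simp [lognormalPDF, this]
  have himage : A ∩ Ioi 0 = Real.exp '' (Real.exp ⁻¹' A) := by
    rw [image_preimage_eq_inter_range, Real.range_exp]
  rw [hzero, add_zero, himage, lintegral_image_eq_lintegral_abs_deriv_mul
    (Real.measurable_exp hA) (fun x _ => (Real.hasDerivAt_exp x).hasDerivWithinAt)
    Real.exp_injective.injOn]
  refine setLIntegral_congr_fun (Real.measurable_exp hA) fun x _ => ?_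
  rw [gaussianPDF, ← ENNReal.ofReal_mul (abs_nonneg _), Real.abs_exp, lognormalPDF,
    if_pos (Real.exp_pos x), Real.log_exp, gaussianPDFReal]
  congr 1
  have e := (Real.exp_pos x).ne'
  have hvs : (v : ℝ) = s ^ 2 := rfl
  rw [hvs, Real.sqrt_mul (by positivity : (0 : ℝ) ≤ 2 * Real.pi) (s ^ 2), Real.sqrt_sq hs.le]
  field_simp

/-- The Cameron–Martin formula: translation by `a` as a change of measure. -/
theorem integral_smul_gaussianReal_shift {E : Type*} [NormedAddCommGroup E] [NormedSpace ℝ E]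
    (m : ℝ) {v : ℝ≥0} (hv : v ≠ 0) (a : ℝ) (F : ℝ → E) :
    ∫ y, Real.exp (((y - m) * a - a ^ 2 / 2) / v) • F y ∂gaussianReal m v
      = ∫ y, F (y + a) ∂gaussianReal m v := by
  rw [integral_gaussianReal_eq_integral_smul hv, integral_gaussianReal_eq_integral_smul hv,
    ← integral_sub_right_eq_self (fun y => gaussianPDFReal m v y • F (y + a)) a]
  refine integral_congr_ae (.of_forall fun y => ?_)
  have hv' : (v : ℝ) ≠ 0 := by exact_mod_cast hv
  simp only [sub_add_cancel, smul_smul]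
  congr 1
  rw [gaussianPDFReal, gaussianPDFReal, mul_assoc, ← Real.exp_add]
  congr 2
  field_simp
  ring

/-- The Cameron–Martin density of the translation by `w` of the normal distribution with mean `m`
and variance `v`, continued to complex `w`. -/
noncomputable def gaussianTilt (m : ℝ) (v : ℝ≥0) (w : ℂ) (y : ℝ) : ℂ :=
  Complex.exp (((y - m) * w - w ^ 2 / 2) / v)

theorem norm_gaussianTilt (m : ℝ) (v : ℝ≥0) (w : ℂ) (y : ℝ) :
    ‖gaussianTilt m v w y‖
      = Real.exp (w.im ^ 2 / (2 * v)) * Real.exp (((y - m) * w.re - w.re ^ 2 / 2) / v) := by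
  have h : ((((y - m) * w - w ^ 2 / 2) / v : ℂ)).re
      = w.im ^ 2 / (2 * v) + ((y - m) * w.re - w.re ^ 2 / 2) / v := by
    have e1 : (((y - m) * w - w ^ 2 / 2) / v : ℂ)
        = ((((v : ℝ)⁻¹ : ℝ)) : ℂ) * (((y - m : ℝ) : ℂ) * w - ((1 / 2 : ℝ) : ℂ) * (w * w)) := by
      push_cast; rw [div_eq_inv_mul]; ring
    rw [e1, Complex.re_ofReal_mul, Complex.sub_re, Complex.re_ofReal_mul, Complex.re_ofReal_mul,
      Complex.mul_re]
    rw [mul_comm (2 : ℝ), ← div_div]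
    simp only [div_eq_mul_inv]
    ring
  rw [gaussianTilt, Complex.norm_exp, h, Real.exp_add]

theorem gaussianTilt_eq (m : ℝ) (v : ℝ≥0) (w : ℂ) (y : ℝ) :
    gaussianTilt m v w y
      = Complex.exp (-(m * w + w ^ 2 / 2) / v) * Complex.exp (w / v * y) := by
  rw [gaussianTilt, ← Complex.exp_add]
  congr 1
  ring

theorem gaussianTilt_ofReal (m : ℝ) (v : ℝ≥0) (a y : ℝ) :
    gaussianTilt m v a y = (Real.exp (((y - m) * a - a ^ 2 / 2) / v) : ℝ) := by
  simp [gaussianTilt]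

theorem integral_gaussianTilt (m : ℝ) {v : ℝ≥0} (hv : v ≠ 0) (w : ℂ) :
    ∫ y, gaussianTilt m v w y ∂gaussianReal m v = 1 := by
  have hv' : (v : ℂ) ≠ 0 := by exact_mod_cast hv
  have h := complexMGF_id_gaussianReal (μ := m) (v := v) (w / v)
  simp only [complexMGF, id] at h
  simp_rw [gaussianTilt_eq]
  rw [integral_const_mul, h, ← Complex.exp_add, ← Complex.exp_zero]
  congr 1
  field_simp
  ring

theorem continuous_gaussianTilt (m : ℝ) (v : ℝ≥0) (w : ℂ) : Continuous (gaussianTilt m v w) := by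
  unfold gaussianTilt; fun_prop

theorem integrable_exp_tilt (m : ℝ) (v : ℝ≥0) (a : ℝ) :
    Integrable (fun y => Real.exp (((y - m) * a - a ^ 2 / 2) / v)) (gaussianReal m v) := by
  refine ((integrable_exp_mul_gaussianReal (μ := m) (v := v) (a / v)).const_mul
    (Real.exp (-(m * a + a ^ 2 / 2) / v))).congr (.of_forall fun y => ?_)
  simp only
  rw [← Real.exp_add]; congr 1; ring

theorem integrable_gaussianTilt (m : ℝ) (v : ℝ≥0) (w : ℂ) :
    Integrable (gaussianTilt m v w) (gaussianReal m v) :=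
  ((integrable_exp_tilt m v w.re).const_mul (Real.exp (w.im ^ 2 / (2 * v)))).mono'
    (continuous_gaussianTilt m v w).aestronglyMeasurable
    (.of_forall fun y => (norm_gaussianTilt m v w y).le)

/-- Up to a factor that depends on `Im w` only, the complex tilt costs no more than the real
translation by `Re w`. -/
theorem norm_integral_mul_gaussianTilt_le (m : ℝ) {v : ℝ≥0} (hv : v ≠ 0) (w : ℂ) (F : ℝ → ℂ) :
    ‖∫ y, F y * gaussianTilt m v w y ∂gaussianReal m v‖
      ≤ Real.exp (w.im ^ 2 / (2 * v)) * ∫ y, ‖F (y + w.re)‖ ∂gaussianReal m v := by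
  rw [← integral_smul_gaussianReal_shift m hv w.re (fun y => ‖F y‖), ← integral_const_mul]
  refine (norm_integral_le_integral_norm _).trans_eq
    (integral_congr_ae (.of_forall fun y => ?_))
  simp only [norm_mul, norm_gaussianTilt, smul_eq_mul]
  ring

/-- The Laplace transform at `exp w` of the lognormal distribution, continued to all `w : ℂ`. For
real `w` it is the integral of `exp (-exp (y + w))` over the normal distribution of `y`; moving the
translation from the integrand to the measure leaves an expression that is entire in `w`. -/
noncomputable def lognormalLogLaplace (m : ℝ) (v : ℝ≥0) (w : ℂ) : ℂ :=
  ∫ y, (Real.exp (-Real.exp y) : ℂ) * gaussianTilt m v w y ∂gaussianReal m v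

theorem integrable_mul_gaussianTilt (m : ℝ) (v : ℝ≥0) (w : ℂ) :
    Integrable (fun y => (Real.exp (-Real.exp y) : ℂ) * gaussianTilt m v w y)
      (gaussianReal m v) := by
  refine (integrable_gaussianTilt m v w).bdd_mul (c := 1)
    (Continuous.aestronglyMeasurable (by fun_prop)) (.of_forall fun y => ?_)
  rw [Complex.norm_real, Real.norm_eq_abs, Real.abs_exp, Real.exp_le_one_iff]
  linarith [Real.exp_pos y]

/-- Up to a Gaussian factor, it is the complex moment generating function of a measure all of
whose exponential moments are finite. -/
theorem differentiable_lognormalLogLaplace (m : ℝ) (v : ℝ≥0) :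
    Differentiable ℂ (lognormalLogLaplace m v) := by
  set ν := (gaussianReal m v).withDensity fun y => ENNReal.ofReal (Real.exp (-Real.exp y)) with hν
  have hle : ν ≤ gaussianReal m v := by
    conv_rhs => rw [← withDensity_one (μ := gaussianReal m v)]
    refine withDensity_mono (.of_forall fun y => ?_)
    simpa using (Real.exp_pos y).le
  have hset : integrableExpSet id ν = univ := by
    refine eq_univ_of_forall fun t => ?_
    exact (integrable_exp_mul_gaussianReal t).mono_measure hle
  have hd : Differentiable ℂ (complexMGF id ν) := fun z =>
    (hasDerivAt_complexMGF (by simp [hset])).differentiableAt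
  have heq : lognormalLogLaplace m v = fun w =>
      Complex.exp (-(m * w + w ^ 2 / 2) / v) * complexMGF id ν (w / v) := by
    funext w
    rw [complexMGF, hν, integral_withDensity_eq_integral_toReal_smul (by fun_prop)
      (.of_forall fun _ => ENNReal.ofReal_lt_top), ← integral_const_mul, lognormalLogLaplace]
    refine integral_congr_ae (.of_forall fun y => ?_)
    simp only [gaussianTilt_eq, ENNReal.toReal_ofReal (Real.exp_pos _).le, Complex.real_smul, id]
    ring
  rw [heq]
  exact (by fun_prop : Differentiable ℂ fun w : ℂ => Complex.exp (-(m * w + w ^ 2 / 2) / v)).mul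
    (hd.comp (by fun_prop))

/-- The three bounds come from `exp (-u) ≤ 1`, `exp (-u) ≤ 1 / u` and `1 - exp (-u) ≤ u` at
`u = exp (y + Re w)`. -/
theorem stripRegular_lognormalLogLaplace (m : ℝ) {v : ℝ≥0} (hv : v ≠ 0) :
    StripRegular (lognormalLogLaplace m v) := by
  refine ⟨differentiable_lognormalLogLaplace m v, fun w => ?_, ?_⟩
  · rw [lognormalLogLaplace, lognormalLogLaplace, ← integral_conj]
    refine integral_congr_ae (.of_forall fun y => ?_)
    simp [gaussianTilt, ← Complex.exp_conj, map_ofNat]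
  set γ := gaussianReal m v with hγ
  have hvpos : (0 : ℝ) < v := by exact_mod_cast pos_iff_ne_zero.2 hv
  have hpos : Integrable (fun y : ℝ => Real.exp y) γ := by
    simpa using integrable_exp_mul_gaussianReal (μ := m) (v := v) 1
  have hneg : Integrable (fun y : ℝ => Real.exp (-y)) γ := by
    simpa using integrable_exp_mul_gaussianReal (μ := m) (v := v) (-1)
  set A := ∫ y, Real.exp (-y) ∂γ with hA
  set B := ∫ y, Real.exp y ∂γ with hB
  have hA0 : 0 ≤ A := integral_nonneg fun y => (Real.exp_pos _).le
  have hB0 : 0 ≤ B := integral_nonneg fun y => (Real.exp_pos _).le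
  set D := Real.exp (Real.pi ^ 2 / (2 * v)) with hD
  have hD0 : 0 < D := Real.exp_pos _
  have hbound : ∀ (w : ℂ), |w.im| ≤ Real.pi → ∀ (F : ℝ → ℂ) (g : ℝ → ℝ), Integrable g γ →
      (∀ y, ‖F (y + w.re)‖ ≤ g y) →
      ‖∫ y, F y * gaussianTilt m v w y ∂γ‖ ≤ D * ∫ y, g y ∂γ := by
    intro w hw F g hg hFg
    refine (norm_integral_mul_gaussianTilt_le m hv w F).trans ?_
    have h1 : w.im ^ 2 ≤ Real.pi ^ 2 := sq_le_sq' (abs_le.1 hw).1 (abs_le.1 hw).2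
    refine mul_le_mul (Real.exp_le_exp.2 (by gcongr)) ?_
      (integral_nonneg fun _ => norm_nonneg _) hD0.le
    exact integral_mono_of_nonneg (.of_forall fun _ => norm_nonneg _) hg (.of_forall hFg)
  refine ⟨D * (1 + A + B), by positivity, fun w hw => ⟨?_, ?_, ?_⟩⟩
  · refine (hbound w hw _ (fun _ => 1) (integrable_const _) fun y => ?_).trans ?_
    · rw [Complex.norm_real, Real.norm_eq_abs, Real.abs_exp, Real.exp_le_one_iff]
      linarith [Real.exp_pos (y + w.re)]
    · rw [integral_const]; simp
      nlinarith
  · refine (hbound w hw _ (fun y => Real.exp (-w.re) * Real.exp (-y)) (hneg.const_mul _)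
      fun y => ?_).trans ?_
    · rw [Complex.norm_real, Real.norm_eq_abs, Real.abs_exp, ← Real.exp_add, Real.exp_le_exp]
      linarith [Real.add_one_le_exp (y + w.re)]
    · rw [integral_const_mul, ← hA]
      have := mul_pos hD0 (Real.exp_pos (-w.re))
      nlinarith [mul_nonneg this.le hB0]
  · have hsub : lognormalLogLaplace m v w - 1
        = ∫ y, ((Real.exp (-Real.exp y) - 1 : ℝ) : ℂ) * gaussianTilt m v w y ∂γ := by
      rw [← integral_gaussianTilt m hv w, lognormalLogLaplace, ← integral_sub
        (integrable_mul_gaussianTilt m v w) (integrable_gaussianTilt m v w)]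
      refine integral_congr_ae (.of_forall fun y => ?_)
      push_cast; ring
    rw [hsub]
    refine (hbound w hw (fun y => ((Real.exp (-Real.exp y) - 1 : ℝ) : ℂ))
      (fun y => Real.exp w.re * Real.exp y) (hpos.const_mul _) fun y => ?_).trans ?_
    · rw [Complex.norm_real, Real.norm_eq_abs, ← Real.exp_add, abs_le]
      have h1 := Real.add_one_le_exp (-Real.exp (y + w.re))
      have h2 : Real.exp (-Real.exp (y + w.re)) ≤ 1 :=
        Real.exp_le_one_iff.2 (by linarith [Real.exp_pos (y + w.re)])
      rw [add_comm y] at h1 h2 ⊢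
      constructor <;> linarith [Real.exp_pos (w.re + y)]
    · rw [integral_const_mul, ← hB]
      have := mul_pos hD0 (Real.exp_pos w.re)
      nlinarith [mul_nonneg this.le hA0]

theorem lognormalLogLaplace_ofReal (m : ℝ) {v : ℝ≥0} (hv : v ≠ 0) (a : ℝ) :
    lognormalLogLaplace m v a
      = ∫ y, Complex.exp (-(Real.exp a) * (Real.exp y)) ∂gaussianReal m v := by
  calc lognormalLogLaplace m v a
      = ∫ y, Real.exp (((y - m) * a - a ^ 2 / 2) / v) • ((Real.exp (-Real.exp y) : ℝ) : ℂ)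
          ∂gaussianReal m v := by
        simp only [lognormalLogLaplace, gaussianTilt_ofReal, Complex.real_smul, mul_comm]
    _ = ∫ y, ((Real.exp (-Real.exp (y + a)) : ℝ) : ℂ) ∂gaussianReal m v :=
        integral_smul_gaussianReal_shift m hv a fun y => ((Real.exp (-Real.exp y) : ℝ) : ℂ)
    _ = _ := by
        refine integral_congr_ae (.of_forall fun y => ?_)
        simp only [Real.exp_add]
        push_cast
        congr 1
        ring

theorem ae_nonneg_lognormalMeasure (m s : ℝ) : ∀ᵐ x ∂lognormalMeasure m s, 0 ≤ x := by
  have : {x : ℝ | ¬ 0 ≤ x} = Iio 0 := by ext; simp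
  rw [ae_iff, this, lognormalMeasure, withDensity_apply _ measurableSet_Iio]
  refine (setLIntegral_congr_fun measurableSet_Iio fun x hx => ?_).trans lintegral_zero
  have : ¬ (0 < x) := not_lt.2 (le_of_lt hx)
  simp [lognormalPDF, this]

theorem analyticOnNhd_integral_exp_neg_mul {ρ : Measure ℝ} [IsFiniteMeasure ρ]
    (hρ : ∀ᵐ x ∂ρ, 0 ≤ x) :
    AnalyticOnNhd ℂ (fun z : ℂ => ∫ x, Complex.exp (-z * x) ∂ρ) {z | 0 < z.re} := by
  have hset : Iio 0 ⊆ interior (integrableExpSet id ρ) := by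
    refine interior_maximal (fun t ht => ?_) isOpen_Iio
    refine (integrable_const (1 : ℝ)).mono' (Continuous.aestronglyMeasurable (by fun_prop)) ?_
    filter_upwards [hρ] with x hx
    rw [Real.norm_eq_abs, Real.abs_exp, Real.exp_le_one_iff]
    exact mul_nonpos_of_nonpos_of_nonneg (le_of_lt ht) hx
  intro z hz
  have h1 : AnalyticAt ℂ (complexMGF id ρ) (-z) :=
    analyticAt_complexMGF (hset (by simpa using hz))
  exact AnalyticAt.fun_comp (f := fun z : ℂ => -z) h1 (by fun_prop)

theorem integral_exp_neg_mul_lognormal (m : ℝ) {s : ℝ} (hs : 0 < s) {z : ℂ} (hz : 0 < z.re) :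
    ∫ x, Complex.exp (-z * x) ∂lognormalMeasure m s
      = lognormalLogLaplace m ⟨s ^ 2, sq_nonneg s⟩ (Complex.log z) := by
  set v : ℝ≥0 := ⟨s ^ 2, sq_nonneg s⟩ with hv
  have hv0 : v ≠ 0 := by
    intro h
    have : s ^ 2 = 0 := congrArg NNReal.toReal h
    exact hs.ne' (by simpa using this)
  have hpos := ae_nonneg_lognormalMeasure m s
  rw [lognormalMeasure_eq_map_gaussianReal m hs, ← hv] at hpos ⊢
  set ρ := (gaussianReal m v).map Real.exp with hρ
  have : IsProbabilityMeasure ρ := Measure.isProbabilityMeasure_map (by fun_prop)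
  have hopen : IsOpen {z : ℂ | 0 < z.re} := isOpen_lt continuous_const Complex.continuous_re
  have han : AnalyticOnNhd ℂ (fun z => lognormalLogLaplace m v (Complex.log z))
      {z : ℂ | 0 < z.re} := by
    refine DifferentiableOn.analyticOnNhd (fun z hz => ?_) hopen
    refine ((differentiable_lognormalLogLaplace m v _).comp z ?_).differentiableWithinAt
    exact Complex.differentiableAt_log (Or.inl hz)
  refine (analyticOnNhd_integral_exp_neg_mul hpos).eqOn_of_preconnected_of_frequently_eq han
    (convex_halfSpace_re_gt 0).isPreconnected (z₀ := 1) (by simp) ?_ hz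
  have hreal : ∀ r : ℝ, 0 < r → ∫ x, Complex.exp (-(r : ℂ) * x) ∂ρ
      = lognormalLogLaplace m v (Complex.log r) := fun r hr => by
    rw [← Complex.ofReal_log hr.le, lognormalLogLaplace_ofReal m hv0, Real.exp_log hr, hρ,
      integral_map (by fun_prop) (Continuous.aestronglyMeasurable (by fun_prop))]
  have htend : Tendsto (fun r : ℝ => (r : ℂ)) (𝓝[≠] 1) (𝓝[≠] 1) := by
    refine tendsto_nhdsWithin_iff.2 ⟨?_, ?_⟩
    · exact (Complex.continuous_ofReal.tendsto' 1 1 (by simp)).mono_left nhdsWithin_le_nhds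
    · filter_upwards [self_mem_nhdsWithin] with r hr
      simpa using hr
  refine htend.frequently (Eventually.frequently ?_)
  filter_upwards [nhdsWithin_le_nhds (lt_mem_nhds one_pos)] with r hr using hreal r hr

/-! ### The jump across the slit and the density -/

/-- The function `t ↦ -(1 / π) Im φ (-t + i0)`, for `φ z = Φ (log z)`. Only its values at `t > 0`
have a meaning. -/
noncomputable def boundaryJump (Φ : ℂ → ℂ) (t : ℝ) : ℝ :=
  -(1 / Real.pi) * (Φ (Real.log t + Real.pi * Complex.I)).im

namespace StripRegular

variable {Φ : ℂ → ℂ}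

theorem aestronglyMeasurable_boundaryJump (hΦ : StripRegular Φ) :
    AEStronglyMeasurable (boundaryJump Φ) (volume.restrict (Ioi 0)) := by
  refine ContinuousOn.aestronglyMeasurable ?_ measurableSet_Ioi
  refine ContinuousOn.mul continuousOn_const ?_
  exact hΦ.continuous_im.comp_continuousOn
    (Real.continuousOn_log.mono fun t ht => (ne_of_gt ht : t ≠ 0))

theorem exists_abs_boundaryJump_le (hΦ : StripRegular Φ) : ∃ C, ∀ t, |boundaryJump Φ t| ≤ C := by
  obtain ⟨C, hC, hb⟩ := hΦ.im_bound
  refine ⟨|-(1 / Real.pi)| * C, fun t => ?_⟩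
  rw [boundaryJump, abs_mul]
  exact mul_le_mul_of_nonneg_left (hb _).1 (abs_nonneg _)

theorem integrableOn_boundaryJump_div (hΦ : StripRegular Φ) :
    IntegrableOn (fun t => boundaryJump Φ t / t) (Ioi 0) := by
  rw [← Real.range_exp, ← image_univ, integrableOn_image_iff_integrableOn_deriv_smul_of_monotoneOn
    MeasurableSet.univ (fun x _ => (Real.hasDerivAt_exp x).hasDerivWithinAt)
    (Real.exp_monotone.monotoneOn _), integrableOn_univ]
  refine (hΦ.integrable_im.const_mul (-(1 / Real.pi))).congr (.of_forall fun x => ?_)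
  simp only [boundaryJump, Real.log_exp, smul_eq_mul]
  have := (Real.exp_pos x).ne'
  field_simp

/-- Cauchy's formula in the coordinate `t = exp x`: `φ` is the Stieltjes transform of its jump. -/
theorem integral_boundaryJump_div (hΦ : StripRegular Φ) {z : ℂ} (hz : 0 < z.re) :
    ∫ t in Ioi (0 : ℝ), (boundaryJump Φ t : ℂ) / (t + z) = Φ (Complex.log z) := by
  rw [← Real.range_exp, ← image_univ, integral_image_eq_integral_deriv_smul_of_monotoneOn
    MeasurableSet.univ (fun x _ => (Real.hasDerivAt_exp x).hasDerivWithinAt)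
    (Real.exp_monotone.monotoneOn _), setIntegral_univ]
  have hpi : (Real.pi : ℂ) ≠ 0 := by exact_mod_cast Real.pi_ne_zero
  have h := hΦ.integral_im_mul_div hz
  have h2 : Φ (Complex.log z) = -(1 / Real.pi) *
      ∫ x : ℝ, ((Φ (x + Real.pi * Complex.I)).im : ℂ) *
        (Complex.exp x / (Complex.exp x + z)) := by
    rw [h]; field_simp
  rw [h2, ← integral_const_mul]
  refine integral_congr_ae (.of_forall fun x => ?_)
  simp only [boundaryJump, Real.log_exp, Complex.real_smul]
  push_cast
  ring

theorem nonneg_and_eq_withDensity_boundaryJump (hΦ : StripRegular Φ) {ρ : Measure ℝ} [IsFiniteMeasure ρ]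
    (hρ : ∀ᵐ x ∂ρ, 0 ≤ x)
    (hlap : ∀ z : ℂ, 0 < z.re → ∫ x, Complex.exp (-z * x) ∂ρ = Φ (Complex.log z)) :
    (∀ x, 0 < x → 0 ≤ ∫ t in Ioi 0, boundaryJump Φ t * Real.exp (-t * x)) ∧
      ρ = (volume.restrict (Ioi (0 : ℝ))).withDensity fun x =>
        ENNReal.ofReal (∫ t in Ioi 0, boundaryJump Φ t * Real.exp (-t * x)) := by
  obtain ⟨C, hC⟩ := hΦ.exists_abs_boundaryJump_le
  have hm := hΦ.aestronglyMeasurable_boundaryJump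
  have hi := hΦ.integrableOn_boundaryJump_div
  refine nonneg_and_eq_withDensity_of_laplace_eq hρ (continuousOn_laplace hm fun t _ => hC t)
    (integrableOn_laplace hm hi) fun z hz => ?_
  rw [hlap z hz, integral_laplace_mul_exp hm hi hz, hΦ.integral_boundaryJump_div hz]

theorem differentiableOn_comp_log (hΦ : StripRegular Φ) :
    DifferentiableOn ℂ (fun z => Φ (Complex.log z)) Complex.slitPlane := fun z hz =>
  ((hΦ.differentiable _).comp z (Complex.differentiableAt_log hz)).differentiableWithinAt

theorem tendsto_comp_log (hΦ : StripRegular Φ) {t : ℝ} (ht : 0 < t) :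
    Tendsto (fun ε : ℝ => Φ (Complex.log (-(t : ℂ) + Complex.I * (ε : ℂ)))) (𝓝[>] (0 : ℝ))
      (𝓝 (Φ (Real.log t + Real.pi * Complex.I))) := by
  have h := Complex.continuousWithinAt_log_of_re_neg_of_im_zero (z := -(t : ℂ)) (by simpa using ht)
    (by simp)
  have hlog : Complex.log (-(t : ℂ)) = Real.log t + Real.pi * Complex.I := by
    apply Complex.ext
    · simp [Complex.log_re]
    · rw [Complex.log_im, ← Complex.ofReal_neg, Complex.arg_ofReal_of_neg (by linarith)]
      simp
  rw [← hlog]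
  refine (hΦ.differentiable.continuous.tendsto _).comp (h.tendsto.comp ?_)
  refine tendsto_nhdsWithin_iff.2 ⟨?_, ?_⟩
  · have hc : Continuous fun ε : ℝ => -(t : ℂ) + Complex.I * (ε : ℂ) := by fun_prop
    exact (hc.tendsto' 0 _ (by simp)).mono_left nhdsWithin_le_nhds
  · filter_upwards [self_mem_nhdsWithin] with ε hε
    simpa using le_of_lt hε

end StripRegular

/-! ### Analytic continuation and sums of independent variables -/

theorem eqOn_slitPlane_of_eqOn_re_pos {φ ψ : ℂ → ℂ} (hφ : DifferentiableOn ℂ φ Complex.slitPlane)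
    (hψ : DifferentiableOn ℂ ψ Complex.slitPlane) (h : ∀ z : ℂ, 0 < z.re → φ z = ψ z) :
    EqOn φ ψ Complex.slitPlane := by
  refine (hφ.analyticOnNhd Complex.isOpen_slitPlane).eqOn_of_preconnected_of_eventuallyEq
    (hψ.analyticOnNhd Complex.isOpen_slitPlane)
    (Complex.starConvex_one_slitPlane.isPathConnected
      Complex.one_mem_slitPlane).isConnected.isPreconnected
    Complex.one_mem_slitPlane ?_
  filter_upwards [(isOpen_lt continuous_const Complex.continuous_re).mem_nhds
    (by simp : (0 : ℝ) < (1 : ℂ).re)] with z hz using h z hz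

theorem laplaceTransform_sum {Ω ι : Type*} [MeasurableSpace Ω] [Fintype ι] {P : Measure Ω}
    {X : ι → Ω → ℝ} (hX : ∀ j, AEMeasurable (X j) P) (hindep : iIndepFun X P) (z : ℂ) :
    laplaceTransform (fun ω => ∑ j, X j ω) P z = ∏ j, laplaceTransform (X j) P z := by
  rw [laplaceTransform]
  simp only [Complex.ofReal_sum, Finset.mul_sum, Complex.exp_sum]
  exact hindep.integral_fun_prod_comp (X := X) (f := fun _ x => Complex.exp (-z * (x : ℂ))) hX
    fun j => Continuous.aestronglyMeasurable (by fun_prop)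

theorem laplaceTransform_eq_integral_map {Ω : Type*} [MeasurableSpace Ω] {P : Measure Ω}
    {X : Ω → ℝ} (hX : AEMeasurable X P) (z : ℂ) :
    laplaceTransform X P z = ∫ x, Complex.exp (-z * x) ∂(P.map X) := by
  rw [laplaceTransform, integral_map hX (Continuous.aestronglyMeasurable (by fun_prop))]

theorem proposition5 {Ω : Type*} [MeasurableSpace Ω] (P : Measure Ω) [IsProbabilityMeasure P]
    (n : ℕ) (hn : 1 ≤ n) (μ σ : Fin n → ℝ) (hσ : ∀ j, 0 < σ j)
    (X : Fin n → Ω → ℝ)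
    (hX : ∀ j, HasLaw (X j) (lognormalMeasure (μ j) (σ j)) P)
    (hindep : iIndepFun X P) :
    -- the Laplace transform of the sum has an analytic continuation to the slit plane
    (∃ φ : ℂ → ℂ, IsLaplaceContinuation (fun ω => ∑ j, X j ω) P φ) ∧
    ∀ φ : ℂ → ℂ, IsLaplaceContinuation (fun ω => ∑ j, X j ω) P φ →
      -- the limits `φ (-t + i0)` exist
      (∀ t : ℝ, 0 < t →
        Tendsto (fun ε : ℝ => φ (-(t : ℂ) + Complex.I * (ε : ℂ))) (𝓝[>] (0 : ℝ))
          (𝓝 (upperBoundaryValue φ t))) ∧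
      -- the integrals converge absolutely
      (∀ x : ℝ, 0 < x →
        IntegrableOn (fun t : ℝ => (upperBoundaryValue φ t).im * Real.exp (-t * x))
          (Ioi (0 : ℝ))) ∧
      -- and their values, as a function of `x`, are the continuous density of the sum
      ContinuousOn (inversionIntegral φ) (Ioi (0 : ℝ)) ∧
      IsDensityOnIoi (fun ω => ∑ j, X j ω) P (inversionIntegral φ) := by
  set S : Ω → ℝ := fun ω => ∑ j, X j ω with hS
  have hSm : AEMeasurable S P :=
    Finset.aemeasurable_fun_sum _ fun j _ => (hX j).aemeasurable
  set Φ : ℂ → ℂ := fun w => ∏ j, lognormalLogLaplace (μ j) ⟨σ j ^ 2, sq_nonneg _⟩ w with hΦdef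
  have hΦ : StripRegular Φ := by
    refine StripRegular.prod ⟨⟨0, hn⟩, Finset.mem_univ _⟩ fun j _ =>
      stripRegular_lognormalLogLaplace _ fun h => ?_
    have : σ j ^ 2 = 0 := congrArg NNReal.toReal h
    exact (hσ j).ne' (by simpa using this)
  have hlap : ∀ z : ℂ, 0 < z.re → laplaceTransform S P z = Φ (Complex.log z) := fun z hz => by
    rw [hS, laplaceTransform_sum (fun j => (hX j).aemeasurable) hindep]
    refine Finset.prod_congr rfl fun j _ => ?_
    rw [laplaceTransform_eq_integral_map (hX j).aemeasurable, (hX j).map_eq,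
      integral_exp_neg_mul_lognormal _ (hσ j) hz]
  refine ⟨⟨fun z => Φ (Complex.log z), hΦ.differentiableOn_comp_log,
    fun z hz => (hlap z hz).symm⟩, fun φ hφ => ?_⟩
  have heq := eqOn_slitPlane_of_eqOn_re_pos hφ.holomorphic hΦ.differentiableOn_comp_log
    fun z hz => (hφ.eq_laplaceTransform z hz).trans (hlap z hz)
  have hlim : ∀ t : ℝ, 0 < t →
      Tendsto (fun ε : ℝ => φ (-(t : ℂ) + Complex.I * (ε : ℂ))) (𝓝[>] (0 : ℝ))
        (𝓝 (Φ (Real.log t + Real.pi * Complex.I))) := fun t ht => by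
    refine (hΦ.tendsto_comp_log ht).congr' ?_
    filter_upwards [self_mem_nhdsWithin] with ε hε
    exact (heq (Or.inr (by simpa using (ne_of_gt hε : ε ≠ 0)))).symm
  have hval : ∀ t : ℝ, 0 < t →
      upperBoundaryValue φ t = Φ (Real.log t + Real.pi * Complex.I) := fun t ht =>
    (hlim t ht).limUnder_eq
  have him : ∀ t : ℝ, 0 < t →
      (upperBoundaryValue φ t).im = -Real.pi * boundaryJump Φ t := fun t ht => by
    rw [hval t ht, boundaryJump]
    field_simp
  have hinv : inversionIntegral φ = fun x =>
      ∫ t in Ioi 0, boundaryJump Φ t * Real.exp (-t * x) := by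
    funext x
    rw [inversionIntegral, ← integral_const_mul]
    refine setIntegral_congr_fun measurableSet_Ioi fun t ht => ?_
    simp only [him t ht]
    field_simp
  obtain ⟨C, hC⟩ := hΦ.exists_abs_boundaryJump_le
  have hm := hΦ.aestronglyMeasurable_boundaryJump
  have hpos : ∀ᵐ x ∂(P.map S), 0 ≤ x := by
    rw [ae_map_iff hSm measurableSet_Ici]
    have : ∀ j, ∀ᵐ ω ∂P, 0 ≤ X j ω := fun j => by
      have := ae_nonneg_lognormalMeasure (μ j) (σ j)
      rw [← (hX j).map_eq] at this
      exact ae_of_ae_map (hX j).aemeasurable this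
    filter_upwards [ae_all_iff.2 this] with ω hω using Finset.sum_nonneg fun j _ => hω j
  have : IsProbabilityMeasure (P.map S) := Measure.isProbabilityMeasure_map hSm
  have hdens := hΦ.nonneg_and_eq_withDensity_boundaryJump hpos fun z hz => by
    rw [← laplaceTransform_eq_integral_map hSm, hlap z hz]
  refine ⟨fun t ht => ?_, fun x hx => ?_, ?_, ?_, hSm, ?_⟩
  · rw [hval t ht]
    exact hlim t ht
  · refine IntegrableOn.congr_fun
      ((integrableOn_mul_exp hm (fun t _ => hC t) hx).const_mul (-Real.pi))
      (fun t ht => ?_) measurableSet_Ioi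
    simp only [him t ht, mul_assoc]
  · rw [hinv]
    exact continuousOn_laplace hm fun t _ => hC t
  · rw [hinv]
    exact hdens.1
  · rw [hinv]
    exact hdens.2
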